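/- **Setting.** Let $(X_i,\mathcal F_i,\mu_i)$, $i=1,2$, be $\sigma$-finite measure spaces and $(X,\mathcal F,\mu)=(X_1\times X_2,\mathcal F_1\otimes\mathcal F_2,\mu_1\otimes\mu_2)$. *Coverings.* A family $\mathcal U=(U_j)_{j\in J}$ is a *product-admissible covering* of $X$ if $J$ is countable, $X=\bigcup_j U_j$, each $U_j=V_j\times W_j$ with $V_j\in\mathcal F_1$, $W_j\in\mathcal F_2$ and $\mu(U_j)>0$, and there is $C>0$ such that the covering weight $(w_{\mathcal U})_j:=\min\{1,\mu_1(V_j),\mu_2(W_j),\mu(U_j)\}$ satisfies $(w_{\mathcal U})_i\le C\,(w_{\mathcal U})_j$ whenever $U_i\cap U_j\ne\emptyset$. For $x\in X$ put $\mathcal U(x):=\bigcup_{j:\,x\in U_j}U_j$; the maximal kernel of $K:X\times X\to\mathbb C$ is $(M_{\mathcal U}K)(x,y):=\sup_{z\in\mathcal U(x)}|K(z,y)|\in[0,\infty]$. A weight $u:X\to(0,\infty)$ is *$\mathcal U$-moderate* if there is $C'>0$ with $u(x)\le C'u(y)$ for all $j\in J$ and $x,y\in U_j$. *Kernels.* For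 a measurable kernel $k$ on $Y\times Y$, $(Y,\nu)$ a $\sigma$-finite measure space, let $\|k\|_{\mathcal A(Y,Y)}:=\max\{\operatorname{ess\,sup}_x\int|k(x,y)|\,d\nu(y),\ \operatorname{ess\,sup}_y\int|k(x,y)|\,d\nu(x)\}$. For measurable $K:X\times X\to\mathbb C$ or $K:X\times X\to[0,\infty]$ let $\|K\|_{\mathcal B}:=\big\|(x_2,y_2)\mapsto\|K((\cdot,x_2),(\cdot,y_2))\|_{\mathcal A(X_1,X_1)}\big\|_{\mathcal A(X_2,X_2)}$, and for measurable $m:X\times X\to(0,\infty)$ let $\|K\|_{\mathcal B_m}:=\|mK\|_{\mathcal B}$; $\mathcal B_m(X,X)$ is the space of measurable $K:X\times X\to\mathbb C$ with $\|K\|_{\mathcal B_m}<\infty$. Put $(\Phi_Kf)(x):=\int_XK(x,y)f(y)\,d\mu(y)$; $\Phi_Kf$ is well defined if this integral exists (i.e. converges absolutely) for almost every $x$. *Function spaces.* A *solid Banach function space* $\mathbf A$ on $X$ is a Banach space of (a.e.-classes of) measurable functions $X\to\mathbb C$ such that $f\in\mathbf A$, $g$ measurable and $|g|\le|f|$ a.e.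 imply $g\in\mathbf A$ and $\|g\|_{\mathbf A}\le\|f\|_{\mathbf A}$. One writes $\mathcal B_m(X,X)\hookrightarrow\mathscr B(\mathbf A)$ if there is a constant $c$ such that for every $K\in\mathcal B_m(X,X)$ the operator $\Phi_K:\mathbf A\to\mathbf A$ is well defined and bounded with $\|\Phi_K\|_{\mathbf A\to\mathbf A}\le c\,\|K\|_{\mathcal B_m}$. For a weight $\omega:X\to(0,\infty)$, $L^\infty_\omega$ is the space of (classes of) measurable $f$ with $\|f\|_{L^\infty_\omega}:=\|\omega f\|_{L^\infty(\mu)}<\infty$. **Theorem.** Let $\mathcal U=(U_j)_{j\in J}$ be a product-admissible covering of $X$. (1) There is a measurable weight $w^c_{\mathcal U}:X\to(0,\infty)$ such that $$\sup_{j\in J}\ \sup_{x\in U_j}\Big[\frac{(w_{\mathcal U})_j}{w^c_{\mathcal U}(x)}+\frac{w^c_{\mathcal U}(x)}{(w_{\mathcal U})_j}\Big]<\infty .\qquad(*)$$ Any two measurable weights $w,w':X\to(0,\infty)$ satisfying $(*)$ are equivalent: there is $C>0$ with $w\le C\,w'$ and $w'\le C\,w$ on $X$. (2) Let $m:X\times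 X\to(0,\infty)$ and $u:X\to(0,\infty)$ be measurable with $m(x,y)\le C\,u(x)\,u(y)$ for all $x,y\in X$ and some constant $C>0$, and let $u$ be $\mathcal U$-moderate. Let $\mathbf A$ be a solid Banach function space on $X$ with $\mathcal B_m(X,X)\hookrightarrow\mathscr B(\mathbf A)$. Let $K:X\times X\to\mathbb C$ be measurable, and suppose that there is a measurable $L:X\times X\to[0,\infty]$ with $M_{\mathcal U}K\le L$ everywhere and $\|L\|_{\mathcal B_m}<\infty$. Let $w^c_{\mathcal U}$ be any measurable weight satisfying $(*)$ and put $v:=u/w^c_{\mathcal U}$. Then $K\in\mathcal B_m(X,X)$, so that $\Phi_K:\mathbf A\to\mathbf A$ is well defined and bounded, and $\Phi_K:\mathbf A\to L^\infty_{1/v}$ is well defined and bounded. -/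

import Mathlib

open MeasureTheory Set Filter
open scoped ENNReal NNReal Topology

noncomputable section

/-- A solid Banach function space on a measure space `(X, μ)`: a complex vector space of
(a.e.-equivalence classes of) measurable functions `X → ℂ`, with a complete norm, such that
`|g| ≤ |f|` a.e. with `f` in the space and `g` measurable implies that `g` is in the space and
`‖g‖ ≤ ‖f‖`. -/
structure SolidBanachFunctionSpace {X : Type*} [MeasurableSpace X] (μ : Measure X) where
  /-- the underlying vector space -/
  carrier : Submodule ℂ (X →ₘ[μ] ℂ)
  /-- the norm -/
  norm : Seminorm ℂ carrier
  /-- the norm is definite -/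
  definite : ∀ f : carrier, norm f = 0 → f = 0
  /-- every Cauchy sequence converges -/
  complete : ∀ F : ℕ → carrier,
    (∀ ε : ℝ, 0 < ε → ∃ N : ℕ, ∀ k ≥ N, ∀ l ≥ N, norm (F k - F l) < ε) →
    ∃ f : carrier, Tendsto (fun n => norm (F n - f)) atTop (𝓝 0)
  /-- solidity -/
  solid : ∀ (f : carrier) (g : X →ₘ[μ] ℂ),
    (∀ᵐ x ∂μ, ‖g x‖ ≤ ‖(f : X →ₘ[μ] ℂ) x‖) →
    ∃ hg : g ∈ carrier, norm ⟨g, hg⟩ ≤ norm f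

/-- The Schur norm `‖k‖_𝒜 ∈ [0,∞]` of a `[0,∞]`-valued kernel: the maximum of
`ess sup_x ∫ k(x,y) dν(y)` and `ess sup_y ∫ k(x,y) dμ(x)`. -/
def kernelNormA {X Y : Type*} [MeasurableSpace X] [MeasurableSpace Y]
    (μ : Measure X) (ν : Measure Y) (k : X × Y → ℝ≥0∞) : ℝ≥0∞ :=
  max (essSup (fun x => ∫⁻ y, k (x, y) ∂ν) μ) (essSup (fun y => ∫⁻ x, k (x, y) ∂μ) ν)

/-- The norm `‖k‖_ℬ ∈ [0,∞]` of a `[0,∞]`-valued kernel on `(X₁ × X₂) × (Y₁ × Y₂)`: the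
`𝒜(X₂,Y₂)`-norm of `(x₂,y₂) ↦ ‖k((·,x₂),(·,y₂))‖_{𝒜(X₁,Y₁)}`. -/
def kernelNormB {X₁ X₂ Y₁ Y₂ : Type*} [MeasurableSpace X₁] [MeasurableSpace X₂]
    [MeasurableSpace Y₁] [MeasurableSpace Y₂] (μ₁ : Measure X₁) (μ₂ : Measure X₂)
    (ν₁ : Measure Y₁) (ν₂ : Measure Y₂) (k : (X₁ × X₂) × (Y₁ × Y₂) → ℝ≥0∞) : ℝ≥0∞ :=
  kernelNormA μ₂ ν₂ fun q : X₂ × Y₂ =>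
    kernelNormA μ₁ ν₁ fun p : X₁ × Y₁ => k ((p.1, q.1), (p.2, q.2))

/-- The weighted norm `‖k‖_{ℬ_m} = ‖m · k‖_ℬ` of a `[0,∞]`-valued kernel, for a weight
`m > 0`. For a complex kernel `K` it is applied to `|K|`. -/
def kernelNormBm {X₁ X₂ Y₁ Y₂ : Type*} [MeasurableSpace X₁] [MeasurableSpace X₂]
    [MeasurableSpace Y₁] [MeasurableSpace Y₂] (μ₁ : Measure X₁) (μ₂ : Measure X₂)
    (ν₁ : Measure Y₁) (ν₂ : Measure Y₂) (m : (X₁ × X₂) × (Y₁ × Y₂) → ℝ)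
    (k : (X₁ × X₂) × (Y₁ × Y₂) → ℝ≥0∞) : ℝ≥0∞ :=
  kernelNormB μ₁ μ₂ ν₁ ν₂ fun z => ENNReal.ofReal (m z) * k z

/-- Membership of a complex kernel in `ℬ_m(X,Y)`. -/
def MemKernelBm {X₁ X₂ Y₁ Y₂ : Type*} [MeasurableSpace X₁] [MeasurableSpace X₂]
    [MeasurableSpace Y₁] [MeasurableSpace Y₂] (μ₁ : Measure X₁) (μ₂ : Measure X₂)
    (ν₁ : Measure Y₁) (ν₂ : Measure Y₂) (m : (X₁ × X₂) × (Y₁ × Y₂) → ℝ)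
    (K : (X₁ × X₂) × (Y₁ × Y₂) → ℂ) : Prop :=
  Measurable K ∧ kernelNormBm μ₁ μ₂ ν₁ ν₂ m (fun z => ‖K z‖ₑ) < ∞

/-- The integral operator `(Φ_K f)(x) = ∫ K(x,y) f(y) dμ(y)`. (Existence of the integral is
always asserted separately.) -/
def kernelOp {X : Type*} [MeasurableSpace X] (μ : Measure X) (K : X × X → ℂ) (f : X → ℂ) :
    X → ℂ :=
  fun x => ∫ y, K (x, y) * f y ∂μ

/-- `Φ_K f` is well defined: the defining integral exists for almost every `x`. -/
def KernelOpExists {X : Type*} [MeasurableSpace X] (μ : Measure X) (K : X × X → ℂ)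
    (f : X → ℂ) : Prop :=
  ∀ᵐ x ∂μ, Integrable (fun y => K (x, y) * f y) μ

/-- `Φ_K : A → A` is well defined, with `‖Φ_K f‖_A ≤ C ‖f‖_A` for all `f ∈ A`. -/
def KernelOpBoundedOn {X : Type*} [MeasurableSpace X] {μ : Measure X} (K : X × X → ℂ)
    (A : SolidBanachFunctionSpace μ) (C : ℝ) : Prop :=
  ∀ f : A.carrier, KernelOpExists μ K (f : X →ₘ[μ] ℂ) ∧
    ∃ g : A.carrier, (g : X →ₘ[μ] ℂ) =ᵐ[μ] kernelOp μ K (f : X →ₘ[μ] ℂ) ∧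
      A.norm g ≤ C * A.norm f

/-- `ℬ_m(X,X) ↪ 𝓑(A)`: every `K ∈ ℬ_m(X,X)` induces a well-defined bounded operator
`Φ_K : A → A`, whose operator norm is at most a constant (independent of `K`) times
`‖K‖_{ℬ_m}`. -/
def KernelBmActsOn {X₁ X₂ : Type*} [MeasurableSpace X₁] [MeasurableSpace X₂]
    (μ₁ : Measure X₁) (μ₂ : Measure X₂) (m : (X₁ × X₂) × (X₁ × X₂) → ℝ)
    (A : SolidBanachFunctionSpace (μ₁.prod μ₂)) : Prop :=
  ∃ C : ℝ, ∀ K : (X₁ × X₂) × (X₁ × X₂) → ℂ, MemKernelBm μ₁ μ₂ μ₁ μ₂ m K →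
    KernelOpBoundedOn K A (C * (kernelNormBm μ₁ μ₂ μ₁ μ₂ m (fun z => ‖K z‖ₑ)).toReal)

/-- `Φ_K : A → L^∞_w` is well defined, with `‖Φ_K f‖_{L^∞_w} ≤ C ‖f‖_A` for all `f ∈ A`, where
`L^∞_w` is the space of (classes of) measurable `g` with
`‖g‖_{L^∞_w} = ‖w · g‖_{L^∞} < ∞`. -/
def KernelOpBoundedIntoWeightedLInfty {X : Type*} [MeasurableSpace X] {μ : Measure X}
    (K : X × X → ℂ) (A : SolidBanachFunctionSpace μ) (w : X → ℝ) (C : ℝ) : Prop :=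
  ∀ f : A.carrier, KernelOpExists μ K (f : X →ₘ[μ] ℂ) ∧
    AEStronglyMeasurable (kernelOp μ K (f : X →ₘ[μ] ℂ)) μ ∧
    eLpNorm (fun x => (w x : ℂ) * kernelOp μ K (f : X →ₘ[μ] ℂ) x) ∞ μ
      ≤ ENNReal.ofReal (C * A.norm f)

/-- The covering weight `(w_𝒰)_j = min {1, μ₁(V_j), μ₂(W_j), μ(V_j × W_j)}`, a number in
`[0,1]`. -/
def coveringWeight {X₁ X₂ J : Type*} [MeasurableSpace X₁] [MeasurableSpace X₂]
    (μ₁ : Measure X₁) (μ₂ : Measure X₂) (V : J → Set X₁) (W : J → Set X₂) (j : J) : ℝ :=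
  (min 1 (min (μ₁ (V j)) (min (μ₂ (W j)) ((μ₁.prod μ₂) (V j ×ˢ W j))))).toReal

/-- The family `U_j = V_j × W_j` is a product-admissible covering of `X₁ × X₂`. (The factors
`V_j`, `W_j` are determined by `U_j`, since `μ(U_j) > 0` forces `U_j ≠ ∅`.) -/
structure IsProductAdmissibleCovering {X₁ X₂ J : Type*} [MeasurableSpace X₁]
    [MeasurableSpace X₂] (μ₁ : Measure X₁) (μ₂ : Measure X₂) (V : J → Set X₁)
    (W : J → Set X₂) : Prop where
  countable : Countable J
  cover : ⋃ j, V j ×ˢ W j = univ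
  measurableSet_left : ∀ j, MeasurableSet (V j)
  measurableSet_right : ∀ j, MeasurableSet (W j)
  measure_pos : ∀ j, 0 < (μ₁.prod μ₂) (V j ×ˢ W j)
  moderate : ∃ C : ℝ, 0 < C ∧ ∀ i j, ((V i ×ˢ W i) ∩ (V j ×ˢ W j)).Nonempty →
    coveringWeight μ₁ μ₂ V W i ≤ C * coveringWeight μ₁ μ₂ V W j

/-- `𝒰(x)`, the union of all `U_j` that contain `x`. -/
def coveringNeighborhood {X J : Type*} (U : J → Set X) (x : X) : Set X :=
  ⋃ (j : J) (_ : x ∈ U j), U j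

/-- The maximal kernel `(M_𝒰 K)(x,y) = sup_{z ∈ 𝒰(x)} |K(z,y)| ∈ [0,∞]`. -/
def maximalKernel {X J : Type*} (U : J → Set X) (K : X × X → ℂ) : X × X → ℝ≥0∞ :=
  fun p => ⨆ z ∈ coveringNeighborhood U p.1, ‖K (z, p.2)‖ₑ

/-- The function `u` is `𝒰`-moderate. -/
def IsModerateFor {X J : Type*} (U : J → Set X) (u : X → ℝ) : Prop :=
  ∃ C : ℝ, 0 < C ∧ ∀ j, ∀ x ∈ U j, ∀ y ∈ U j, u x ≤ C * u y

/-- A measurable weight `w : X → (0,∞)` that is a continuous version of the discrete covering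
weight: `sup_j sup_{x ∈ U_j} [(w_𝒰)_j / w(x) + w(x) / (w_𝒰)_j] < ∞`. -/
structure IsContinuousCoveringWeight {X₁ X₂ J : Type*} [MeasurableSpace X₁]
    [MeasurableSpace X₂] (μ₁ : Measure X₁) (μ₂ : Measure X₂) (V : J → Set X₁)
    (W : J → Set X₂) (w : X₁ × X₂ → ℝ) : Prop where
  measurable : Measurable w
  pos : ∀ x, 0 < w x
  comparable : ∃ C : ℝ, ∀ j, ∀ x ∈ V j ×ˢ W j,
    coveringWeight μ₁ μ₂ V W j / w x + w x / coveringWeight μ₁ μ₂ V W j ≤ C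

end

/-! Fix `f` in `A` and `x ∈ U_j`. For every `z ∈ U_j` the hypothesis on the maximal kernel gives
`|K(x,y)| ≤ L(z,y)`, so the single number `τ = ∫ |K(x,y)| |f(y)| dμ(y)` is a lower bound on all of
`U_j` for the function `z ↦ ∫ L(z,y) |f(y)| dμ(y)`. That function has `A`-norm at most a constant
times `‖f‖`, because kernels of finite `ℬ_m`-norm act on `A`. As `L` may take the value `∞`, this is
done for the truncations `min(L,n)` with a bound independent of `n`
(`exists_norm_le_lintegral_min`), followed by monotone convergence.

It remains to see that a function of modulus at least `t` on `U_j` has norm at least a constant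
times `t (w_𝒰)_j / u(x)` (`exists_mul_coveringWeight_le`). Fix once and for all a set `E` with `1_E`
in `A` and `‖1_E‖ > 0`. For a rectangle `F = F₁ × F₂ ⊆ U_j` of finite measure, the kernel `1_E ⊗
1_F` maps `1_F` to `μ(F) 1_E`, and its `ℬ_m`-norm is computed factor by factor
(`measure_mul_norm_le`). This yields the lower bound with the minimum in the covering weight
absorbing the maxima in the kernel norm. The two estimates together bound `τ` by a multiple of
`(u/w)(x) ‖f‖` at every point `x` (`exists_lintegral_enorm_le`). -/

/-! ### The discrete covering weight and its continuous versions. -/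

section CoveringWeight

variable {X₁ X₂ J : Type*} [MeasurableSpace X₁] [MeasurableSpace X₂]
  {μ₁ : Measure X₁} {μ₂ : Measure X₂} {V : J → Set X₁} {W : J → Set X₂}

theorem coveringWeight_le_one (j : J) : coveringWeight μ₁ μ₂ V W j ≤ 1 := by
  unfold coveringWeight
  exact ENNReal.toReal_le_of_le_ofReal zero_le_one (by simp)

theorem min_one_mul_min_one (a b : ℝ≥0∞) :
    min 1 a * min 1 b = min 1 (min a (min b (a * b))) := by
  rcases le_total 1 a with ha | ha <;> rcases le_total 1 b with hb | hb
  · have : 1 ≤ a * b := one_le_mul_of_one_le_of_one_le ha hb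
    simp [ha, hb, this]
  · have h1 : b ≤ a * b := le_mul_of_one_le_left' ha
    rw [min_eq_left ha, min_eq_right hb, one_mul, min_eq_left h1, min_eq_right (hb.trans ha),
      min_eq_right hb]
  · have h1 : a ≤ a * b := le_mul_of_one_le_right' hb
    rw [min_eq_left hb, min_eq_right ha, mul_one, min_eq_left (le_min (ha.trans hb) h1),
      min_eq_right ha]
  · have h1 : a * b ≤ b := mul_le_of_le_one_left' ha
    have h2 : a * b ≤ a := mul_le_of_le_one_right' hb
    rw [min_eq_right ha, min_eq_right hb, min_eq_right h1, min_eq_right h2,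
      min_eq_right (h2.trans ha)]

/-- The product form lets the two factors of `U_j` be treated independently, both for positivity and
when each is replaced by a subset of finite measure. -/
theorem coveringWeight_eq_mul [SFinite μ₂] (j : J) :
    coveringWeight μ₁ μ₂ V W j = (min 1 (μ₁ (V j))).toReal * (min 1 (μ₂ (W j))).toReal := by
  rw [coveringWeight, Measure.prod_prod, ← ENNReal.toReal_mul, min_one_mul_min_one]

namespace IsProductAdmissibleCovering

theorem measure_left_pos [SFinite μ₂] (hU : IsProductAdmissibleCovering μ₁ μ₂ V W)
    (j : J) : 0 < μ₁ (V j) := by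
  have h := hU.measure_pos j
  rw [Measure.prod_prod] at h
  exact pos_of_ne_zero fun h0 => by simp [h0] at h

theorem measure_right_pos [SFinite μ₂] (hU : IsProductAdmissibleCovering μ₁ μ₂ V W)
    (j : J) : 0 < μ₂ (W j) := by
  have h := hU.measure_pos j
  rw [Measure.prod_prod] at h
  exact pos_of_ne_zero fun h0 => by simp [h0] at h

theorem coveringWeight_pos [SFinite μ₂] (hU : IsProductAdmissibleCovering μ₁ μ₂ V W)
    (j : J) : 0 < coveringWeight μ₁ μ₂ V W j := by
  rw [coveringWeight_eq_mul]
  have h1 := hU.measure_left_pos j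
  have h2 := hU.measure_right_pos j
  exact mul_pos
    (ENNReal.toReal_pos (lt_min one_pos h1).ne' (min_lt_of_left_lt ENNReal.one_lt_top).ne)
    (ENNReal.toReal_pos (lt_min one_pos h2).ne' (min_lt_of_left_lt ENNReal.one_lt_top).ne)

theorem exists_mem (hU : IsProductAdmissibleCovering μ₁ μ₂ V W) (x : X₁ × X₂) : ∃ j, x ∈ V j ×ˢ W j := by
  have h : x ∈ ⋃ j, V j ×ˢ W j := hU.cover ▸ mem_univ x
  exact mem_iUnion.1 h

/-- The pointwise supremum of `(w_𝒰)_j` over the `U_j` containing the point works: countability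
makes it measurable, and moderateness of the covering bounds it by a multiple of any single
competitor. -/
theorem exists_isContinuousCoveringWeight [SFinite μ₂]
    (hU : IsProductAdmissibleCovering μ₁ μ₂ V W) :
    ∃ w : X₁ × X₂ → ℝ, IsContinuousCoveringWeight μ₁ μ₂ V W w := by
  obtain ⟨C, hC, hmod⟩ := hU.moderate
  have := hU.countable
  let c : J → ℝ := coveringWeight μ₁ μ₂ V W
  have hc : ∀ j, 0 < c j := hU.coveringWeight_pos
  let g : J → X₁ × X₂ → ℝ := fun j => (V j ×ˢ W j).indicator fun _ => c j
  -- A real supremum over an unbounded family would be the default value `0`; the cap at `1` in the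
  -- covering weight excludes this.
  have hbdd : ∀ x, BddAbove (range fun j => g j x) := fun x => ⟨1, by
    rintro _ ⟨j, rfl⟩
    exact indicator_apply_le' (fun _ => coveringWeight_le_one j) fun _ => zero_le_one⟩
  have hlow : ∀ j, ∀ x ∈ V j ×ˢ W j, c j ≤ ⨆ i, g i x := fun j x hx =>
    (indicator_of_mem hx fun _ => c j).symm.le.trans (le_ciSup (hbdd x) j)
  have hup : ∀ j, ∀ x ∈ V j ×ˢ W j, ⨆ i, g i x ≤ C * c j := fun j x hx => by
    have : Nonempty J := ⟨j⟩
    exact ciSup_le fun i => indicator_apply_le' (fun hi => hmod i j ⟨x, hi, hx⟩)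
      fun _ => (mul_pos hC (hc j)).le
  have hpos : ∀ x, 0 < ⨆ i, g i x := fun x => by
    obtain ⟨j, hj⟩ := hU.exists_mem x
    exact (hc j).trans_le (hlow j x hj)
  refine ⟨fun x => ⨆ j, g j x, ?_, hpos, 1 + C, fun j x hx => add_le_add ?_ ?_⟩
  · exact Measurable.iSup fun j => measurable_const.indicator
      ((hU.measurableSet_left j).prod (hU.measurableSet_right j))
  · exact (div_le_one (hpos x)).2 (hlow j x hx)
  · exact (div_le_iff₀ (hc j)).2 (hup j x hx)

end IsProductAdmissibleCovering

theorem IsContinuousCoveringWeight.exists_bounds [SFinite μ₂]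
    (hU : IsProductAdmissibleCovering μ₁ μ₂ V W) {w : X₁ × X₂ → ℝ}
    (hw : IsContinuousCoveringWeight μ₁ μ₂ V W w) :
    ∃ C : ℝ, 0 < C ∧ ∀ j, ∀ x ∈ V j ×ˢ W j,
      coveringWeight μ₁ μ₂ V W j ≤ C * w x ∧ w x ≤ C * coveringWeight μ₁ μ₂ V W j := by
  obtain ⟨C, hC⟩ := hw.comparable
  refine ⟨max C 1, by positivity, fun j x hx => ?_⟩
  have hc := hU.coveringWeight_pos j
  have hx' := hw.pos x
  have h := (hC j x hx).trans (le_max_left C 1)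
  -- Both quotients are positive, so a bound on their sum bounds each one.
  have h1 : 0 < coveringWeight μ₁ μ₂ V W j / w x := div_pos hc hx'
  have h2 : 0 < w x / coveringWeight μ₁ μ₂ V W j := div_pos hx' hc
  exact ⟨(div_le_iff₀ hx').1 (by linarith), (div_le_iff₀ hc).1 (by linarith)⟩

theorem IsContinuousCoveringWeight.equivalent [SFinite μ₂]
    (hU : IsProductAdmissibleCovering μ₁ μ₂ V W) {w w' : X₁ × X₂ → ℝ}
    (hw : IsContinuousCoveringWeight μ₁ μ₂ V W w)
    (hw' : IsContinuousCoveringWeight μ₁ μ₂ V W w') :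
    ∃ C : ℝ, 0 < C ∧ ∀ x, w x ≤ C * w' x ∧ w' x ≤ C * w x := by
  obtain ⟨C, hC, h⟩ := hw.exists_bounds hU
  obtain ⟨C', hC', h'⟩ := hw'.exists_bounds hU
  refine ⟨C * C', mul_pos hC hC', fun x => ?_⟩
  obtain ⟨j, hj⟩ := hU.exists_mem x
  constructor
  · calc w x ≤ C * coveringWeight μ₁ μ₂ V W j := (h j x hj).2
      _ ≤ C * (C' * w' x) := by gcongr; exact (h' j x hj).1
      _ = C * C' * w' x := by ring
  · calc w' x ≤ C' * coveringWeight μ₁ μ₂ V W j := (h' j x hj).2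
      _ ≤ C' * (C * w x) := by gcongr; exact (h j x hj).1
      _ = C * C' * w x := by ring

end CoveringWeight

/-! ### Monotonicity and product estimates for the kernel norms. -/

section KernelNorms

theorem kernelNormA_mono {X Y : Type*} [MeasurableSpace X] [MeasurableSpace Y]
    (μ : Measure X) (ν : Measure Y) {k l : X × Y → ℝ≥0∞} (h : ∀ p, k p ≤ l p) :
    kernelNormA μ ν k ≤ kernelNormA μ ν l :=
  max_le_max (essSup_mono_ae (.of_forall fun _ => lintegral_mono fun _ => h _))
    (essSup_mono_ae (.of_forall fun _ => lintegral_mono fun _ => h _))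

theorem kernelNormA_le_of_le_indicator {X Y : Type*} [MeasurableSpace X] [MeasurableSpace Y]
    (μ : Measure X) (ν : Measure Y) {E : Set X} {F : Set Y} (hE : MeasurableSet E)
    (hF : MeasurableSet F) {k : X × Y → ℝ≥0∞} {c : ℝ≥0∞}
    (hk : ∀ x y, k (x, y) ≤ c * (E.indicator 1 x * F.indicator 1 y)) :
    kernelNormA μ ν k ≤ c * max (μ E) (ν F) := by
  refine max_le (essSup_le_of_ae_le _ (.of_forall fun x => ?_))
    (essSup_le_of_ae_le _ (.of_forall fun y => ?_))
  · calc ∫⁻ y, k (x, y) ∂ν ≤ ∫⁻ y, c * F.indicator 1 y ∂ν := by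
          refine lintegral_mono fun y => (hk x y).trans ?_
          gcongr
          exact mul_le_of_le_one_left' (indicator_le_self' (fun _ _ => zero_le) x)
      _ = c * ν F := by
          rw [lintegral_const_mul _ (measurable_one.indicator hF), lintegral_indicator_one hF]
      _ ≤ c * max (μ E) (ν F) := by gcongr; exact le_max_right _ _
  · calc ∫⁻ x, k (x, y) ∂μ ≤ ∫⁻ x, c * E.indicator 1 x ∂μ := by
          refine lintegral_mono fun x => (hk x y).trans ?_
          gcongr
          exact mul_le_of_le_one_right' (indicator_le_self' (fun _ _ => zero_le) y)
      _ = c * μ E := by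
          rw [lintegral_const_mul _ (measurable_one.indicator hE), lintegral_indicator_one hE]
      _ ≤ c * max (μ E) (ν F) := by gcongr; exact le_max_left _ _

variable {X₁ X₂ Y₁ Y₂ : Type*} [MeasurableSpace X₁] [MeasurableSpace X₂]
  [MeasurableSpace Y₁] [MeasurableSpace Y₂] (μ₁ : Measure X₁) (μ₂ : Measure X₂)
  (ν₁ : Measure Y₁) (ν₂ : Measure Y₂)

theorem kernelNormBm_mono (m : (X₁ × X₂) × (Y₁ × Y₂) → ℝ)
    {k l : (X₁ × X₂) × (Y₁ × Y₂) → ℝ≥0∞} (h : ∀ p, k p ≤ l p) :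
    kernelNormBm μ₁ μ₂ ν₁ ν₂ m k ≤ kernelNormBm μ₁ μ₂ ν₁ ν₂ m l := by
  unfold kernelNormBm kernelNormB
  exact kernelNormA_mono _ _ fun _ => kernelNormA_mono _ _ fun _ => mul_le_mul_right (h _) _

/-- The indicator of a rectangle is a product, so the inner Schur estimate leaves a kernel of the
same shape in the outer variables. -/
theorem kernelNormB_le_of_le_indicator {E₁ : Set X₁} {E₂ : Set X₂} {F₁ : Set Y₁} {F₂ : Set Y₂}
    (hE₁ : MeasurableSet E₁) (hE₂ : MeasurableSet E₂) (hF₁ : MeasurableSet F₁)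
    (hF₂ : MeasurableSet F₂) {k : (X₁ × X₂) × (Y₁ × Y₂) → ℝ≥0∞} {c : ℝ≥0∞}
    (hk : ∀ x y, k (x, y) ≤ c * ((E₁ ×ˢ E₂).indicator 1 x * (F₁ ×ˢ F₂).indicator 1 y)) :
    kernelNormB μ₁ μ₂ ν₁ ν₂ k ≤ c * max (μ₁ E₁) (ν₁ F₁) * max (μ₂ E₂) (ν₂ F₂) := by
  refine kernelNormA_le_of_le_indicator _ _ hE₂ hF₂ fun x₂ y₂ => ?_
  refine (kernelNormA_le_of_le_indicator μ₁ ν₁ hE₁ hF₁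
    (c := c * (E₂.indicator 1 x₂ * F₂.indicator 1 y₂)) fun x₁ y₁ => ?_).trans_eq (by ring)
  refine (hk _ _).trans_eq ?_
  have h1 : (E₁ ×ˢ E₂).indicator (1 : X₁ × X₂ → ℝ≥0∞) (x₁, x₂)
      = E₁.indicator 1 x₁ * E₂.indicator 1 x₂ := indicator_prod_one
  have h2 : (F₁ ×ˢ F₂).indicator (1 : Y₁ × Y₂ → ℝ≥0∞) (y₁, y₂)
      = F₁.indicator 1 y₁ * F₂.indicator 1 y₂ := indicator_prod_one
  rw [h1, h2]
  ring

end KernelNorms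

/-! ### Consequences of solidity. -/

namespace SolidBanachFunctionSpace

variable {X : Type*} [MeasurableSpace X] {μ : Measure X} (A : SolidBanachFunctionSpace μ)

theorem norm_mono {f g : A.carrier}
    (h : ∀ᵐ x ∂μ, ‖(g : X →ₘ[μ] ℂ) x‖ ≤ ‖(f : X →ₘ[μ] ℂ) x‖) : A.norm g ≤ A.norm f :=
  (A.solid f g h).2

/-- Solidity applies to `t · 1_s`, which `|f|` dominates; then divide by `t`. -/
theorem exists_eq_indicator {s : Set X} (hs : MeasurableSet s) (f : A.carrier) {t : ℝ}
    (ht : 0 < t) (h : ∀ᵐ x ∂μ, x ∈ s → t ≤ ‖(f : X →ₘ[μ] ℂ) x‖) :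
    ∃ g : A.carrier, (g : X →ₘ[μ] ℂ) =ᵐ[μ] s.indicator (fun _ => (1 : ℂ)) ∧
      t * A.norm g ≤ A.norm f := by
  have hm : AEStronglyMeasurable (s.indicator fun _ => (t : ℂ)) μ :=
    (stronglyMeasurable_const.indicator hs).aestronglyMeasurable
  have hle : ∀ᵐ x ∂μ, ‖AEEqFun.mk _ hm x‖ ≤ ‖(f : X →ₘ[μ] ℂ) x‖ := by
    filter_upwards [AEEqFun.coeFn_mk _ hm, h] with x hx hfx
    rw [hx]
    by_cases hxs : x ∈ s
    · simpa [hxs, abs_of_pos ht] using hfx hxs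
    · simp [hxs]
  obtain ⟨hg, hgn⟩ := A.solid f (AEEqFun.mk _ hm) hle
  refine ⟨((t⁻¹ : ℝ) : ℂ) • ⟨_, hg⟩, ?_, ?_⟩
  · filter_upwards [AEEqFun.coeFn_mk _ hm,
      AEEqFun.coeFn_smul ((t⁻¹ : ℝ) : ℂ) (AEEqFun.mk _ hm)] with x hx hx'
    rw [Submodule.coe_smul, hx', Pi.smul_apply, hx]
    by_cases hxs : x ∈ s
    · simp [hxs, ht.ne']
    · simp [hxs]
  · rw [map_smul_eq_mul, Complex.norm_real, Real.norm_eq_abs, abs_of_pos (inv_pos.2 ht),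
      mul_inv_cancel_left₀ ht.ne']
    exact hgn

theorem exists_norm (f : A.carrier) :
    ∃ g : A.carrier, (g : X →ₘ[μ] ℂ) =ᵐ[μ] (fun x => ((‖(f : X →ₘ[μ] ℂ) x‖ : ℝ) : ℂ)) ∧
      A.norm g ≤ A.norm f := by
  have hm : AEStronglyMeasurable (fun x => ((‖(f : X →ₘ[μ] ℂ) x‖ : ℝ) : ℂ)) μ :=
    Complex.continuous_ofReal.comp_aestronglyMeasurable
      (f : X →ₘ[μ] ℂ).stronglyMeasurable.norm.aestronglyMeasurable
  have hle : ∀ᵐ x ∂μ, ‖AEEqFun.mk _ hm x‖ ≤ ‖(f : X →ₘ[μ] ℂ) x‖ := by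
    filter_upwards [AEEqFun.coeFn_mk _ hm] with x hx
    simp [hx]
  obtain ⟨hg, hgn⟩ := A.solid f _ hle
  exact ⟨⟨_, hg⟩, AEEqFun.coeFn_mk _ hm, hgn⟩

end SolidBanachFunctionSpace

/-! ### Testing on rank-one kernels. -/

section RankOne

variable {X₁ X₂ : Type*} [MeasurableSpace X₁] [MeasurableSpace X₂]
  {μ₁ : Measure X₁} {μ₂ : Measure X₂}

theorem kernelNormBm_rankOne_le {m : (X₁ × X₂) × (X₁ × X₂) → ℝ} {D : ℝ}
    {E : Set (X₁ × X₂)} {E₁ F₁ : Set X₁} {E₂ F₂ : Set X₂} (hE₁ : MeasurableSet E₁)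
    (hE₂ : MeasurableSet E₂) (hF₁ : MeasurableSet F₁) (hF₂ : MeasurableSet F₂)
    (hE : E ⊆ E₁ ×ˢ E₂) (hm : ∀ x ∈ E, ∀ y ∈ F₁ ×ˢ F₂, m (x, y) ≤ D) :
    kernelNormBm μ₁ μ₂ μ₁ μ₂ m
      (fun z => ‖E.indicator (fun _ => (1 : ℂ)) z.1
        * (F₁ ×ˢ F₂).indicator (fun _ => (1 : ℂ)) z.2‖ₑ)
      ≤ ENNReal.ofReal D * max (μ₁ E₁) (μ₁ F₁) * max (μ₂ E₂) (μ₂ F₂) := by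
  refine kernelNormB_le_of_le_indicator _ _ _ _ hE₁ hE₂ hF₁ hF₂ fun x y => ?_
  by_cases hx : x ∈ E
  · by_cases hy : y ∈ F₁ ×ˢ F₂
    · simp only [indicator_of_mem hx, indicator_of_mem hy, indicator_of_mem (hE hx),
        Pi.one_apply, mul_one, enorm_one]
      exact ENNReal.ofReal_le_ofReal (hm x hx y hy)
    · simp only [indicator_of_notMem hy, mul_zero, enorm_zero, le_refl]
  · simp only [indicator_of_notMem hx, zero_mul, mul_zero, enorm_zero, zero_le]

/-- Testing boundedness on the rank-one kernel `1_E ⊗ 1_F` bounds the norm of `1_F` from below. -/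
theorem measure_mul_norm_le [SigmaFinite μ₂] {A : SolidBanachFunctionSpace (μ₁.prod μ₂)}
    {m : (X₁ × X₂) × (X₁ × X₂) → ℝ} {c : ℝ}
    (hact : ∀ K, MemKernelBm μ₁ μ₂ μ₁ μ₂ m K →
      KernelOpBoundedOn K A (c * (kernelNormBm μ₁ μ₂ μ₁ μ₂ m (fun z => ‖K z‖ₑ)).toReal))
    {D : ℝ} {E : Set (X₁ × X₂)} {E₁ F₁ : Set X₁} {E₂ F₂ : Set X₂} (hEm : MeasurableSet E)
    (hE₁ : MeasurableSet E₁) (hE₂ : MeasurableSet E₂) (hF₁ : MeasurableSet F₁)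
    (hF₂ : MeasurableSet F₂) (hE₁' : μ₁ E₁ < ∞) (hE₂' : μ₂ E₂ < ∞) (hF₁' : μ₁ F₁ < ∞)
    (hF₂' : μ₂ F₂ < ∞) (hE : E ⊆ E₁ ×ˢ E₂) (hD : 0 ≤ D)
    (hm : ∀ x ∈ E, ∀ y ∈ F₁ ×ˢ F₂, m (x, y) ≤ D) {e f : A.carrier}
    (he : (e : X₁ × X₂ →ₘ[μ₁.prod μ₂] ℂ) =ᵐ[μ₁.prod μ₂] E.indicator fun _ => (1 : ℂ))
    (hf : (f : X₁ × X₂ →ₘ[μ₁.prod μ₂] ℂ) =ᵐ[μ₁.prod μ₂]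
      (F₁ ×ˢ F₂).indicator fun _ => (1 : ℂ)) :
    μ₁.real F₁ * μ₂.real F₂ * A.norm e
      ≤ |c| * (D * max (μ₁.real E₁) (μ₁.real F₁) * max (μ₂.real E₂) (μ₂.real F₂)) * A.norm f := by
  set K : (X₁ × X₂) × (X₁ × X₂) → ℂ := fun z => E.indicator (fun _ => (1 : ℂ)) z.1
        * (F₁ ×ˢ F₂).indicator (fun _ => (1 : ℂ)) z.2 with hK
  have hF : MeasurableSet (F₁ ×ˢ F₂) := hF₁.prod hF₂
  have hKm : Measurable K :=
    ((measurable_const.indicator hEm).comp measurable_fst).mul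
      ((measurable_const.indicator hF).comp measurable_snd)
  have hKle := kernelNormBm_rankOne_le (μ₁ := μ₁) (μ₂ := μ₂) hE₁ hE₂ hF₁ hF₂ hE hm
  have hfin : ENNReal.ofReal D * max (μ₁ E₁) (μ₁ F₁) * max (μ₂ E₂) (μ₂ F₂) < ∞ :=
    ENNReal.mul_lt_top (ENNReal.mul_lt_top ENNReal.ofReal_lt_top (max_lt hE₁' hF₁'))
      (max_lt hE₂' hF₂')
  have hreal : (kernelNormBm μ₁ μ₂ μ₁ μ₂ m (fun z => ‖K z‖ₑ)).toReal
      ≤ D * max (μ₁.real E₁) (μ₁.real F₁) * max (μ₂.real E₂) (μ₂.real F₂) := by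
    refine (ENNReal.toReal_mono hfin.ne hKle).trans_eq ?_
    rw [ENNReal.toReal_mul, ENNReal.toReal_mul, ENNReal.toReal_ofReal hD,
      ENNReal.toReal_max hE₁'.ne hF₁'.ne, ENNReal.toReal_max hE₂'.ne hF₂'.ne]
    rfl
  obtain ⟨-, g, hg, hgn⟩ := hact K ⟨hKm, hKle.trans_lt hfin⟩ f
  -- Since `f = 1_F` almost everywhere, `Φ_K f = μ(F) 1_E`.
  have hop : ∀ x, kernelOp (μ₁.prod μ₂) K (f : X₁ × X₂ →ₘ[μ₁.prod μ₂] ℂ) x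
      = ((μ₁.real F₁ * μ₂.real F₂ : ℝ) : ℂ) * E.indicator (fun _ => (1 : ℂ)) x := fun x => by
    have h1 : ∀ᵐ y ∂μ₁.prod μ₂, K (x, y) * (f : X₁ × X₂ →ₘ[μ₁.prod μ₂] ℂ) y
        = E.indicator (fun _ => (1 : ℂ)) x * (F₁ ×ˢ F₂).indicator (fun _ => (1 : ℂ)) y := by
      filter_upwards [hf] with y hy
      rw [hy, hK]
      by_cases hyF : y ∈ F₁ ×ˢ F₂
      · simp only [indicator_of_mem hyF, mul_one]
      · simp only [indicator_of_notMem hyF, mul_zero]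
    rw [kernelOp, integral_congr_ae h1, integral_const_mul, integral_indicator_const _ hF,
      measureReal_prod_prod, mul_comm, Complex.real_smul, mul_one]
  calc μ₁.real F₁ * μ₂.real F₂ * A.norm e
      = A.norm (((μ₁.real F₁ * μ₂.real F₂ : ℝ) : ℂ) • e) := by
        rw [map_smul_eq_mul, Complex.norm_real, Real.norm_of_nonneg (by positivity)]
    _ ≤ A.norm g := A.norm_mono (by
        filter_upwards [hg, he, AEEqFun.coeFn_smul ((μ₁.real F₁ * μ₂.real F₂ : ℝ) : ℂ)
          (e : X₁ × X₂ →ₘ[μ₁.prod μ₂] ℂ)] with x h1 h2 h3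
        rw [Submodule.coe_smul, h3, h1, hop, Pi.smul_apply, h2, smul_eq_mul])
    _ ≤ c * (kernelNormBm μ₁ μ₂ μ₁ μ₂ m (fun z => ‖K z‖ₑ)).toReal * A.norm f := hgn
    _ ≤ _ := by
        have := apply_nonneg A.norm f
        gcongr
        exact le_abs_self c

end RankOne

/-! ### The lower bound for norms of functions that are large on a covering set. -/

section LowerBound

variable {X₁ X₂ J : Type*} [MeasurableSpace X₁] [MeasurableSpace X₂]
  {μ₁ : Measure X₁} {μ₂ : Measure X₂} [SigmaFinite μ₁] [SigmaFinite μ₂]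

/-- A nonzero solid space contains the indicator of a non-null set of finite extent, on which
a given function is bounded. -/
theorem SolidBanachFunctionSpace.exists_indicator_norm_pos
    (A : SolidBanachFunctionSpace (μ₁.prod μ₂)) {u : X₁ × X₂ → ℝ} (hu : Measurable u)
    {f : A.carrier} (hf : f ≠ 0) :
    ∃ (M : ℝ) (E : Set (X₁ × X₂)) (E₁ : Set X₁) (E₂ : Set X₂) (e : A.carrier),
      0 < M ∧ MeasurableSet E ∧ MeasurableSet E₁ ∧ MeasurableSet E₂ ∧ μ₁ E₁ < ∞ ∧ μ₂ E₂ < ∞ ∧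
      E ⊆ E₁ ×ˢ E₂ ∧ (∀ x ∈ E, u x ≤ M) ∧
      (e : X₁ × X₂ →ₘ[μ₁.prod μ₂] ℂ) =ᵐ[μ₁.prod μ₂] (E.indicator fun _ => (1 : ℂ)) ∧
      0 < A.norm e := by
  let φ : X₁ × X₂ →ₘ[μ₁.prod μ₂] ℂ := f
  -- These sets exhaust `{f ≠ 0}`, so one of them is non-null; each has all the required bounds
  -- built in.
  let S : ℕ → Set (X₁ × X₂) := fun n =>
    ({x | 1 / ((n : ℝ) + 1) ≤ ‖φ x‖} ∩ {x | u x ≤ (n : ℝ) + 1}) ∩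
      spanningSets μ₁ n ×ˢ spanningSets μ₂ n
  have hS : ∀ n, MeasurableSet (S n) := fun n =>
    ((measurableSet_le measurable_const φ.stronglyMeasurable.norm.measurable).inter
      (measurableSet_le hu measurable_const)).inter
      ((measurableSet_spanningSets μ₁ n).prod (measurableSet_spanningSets μ₂ n))
  have hcov : ∀ x, φ x ≠ 0 → ∃ n, x ∈ S n := fun x hx => by
    obtain ⟨n₁, h₁⟩ := exists_nat_one_div_lt (norm_pos_iff.2 hx)
    obtain ⟨n₂, h₂⟩ := exists_nat_ge (u x)
    let n := max (max n₁ n₂) (max (spanningSetsIndex μ₁ x.1) (spanningSetsIndex μ₂ x.2))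
    have hn₁ : (n₁ : ℝ) ≤ n := by exact_mod_cast le_max_of_le_left (le_max_left _ _)
    have hn₂ : (n₂ : ℝ) ≤ n := by exact_mod_cast le_max_of_le_left (le_max_right _ _)
    refine ⟨n, ⟨?_, ?_⟩, ?_, ?_⟩
    · exact (one_div_le_one_div_of_le (by positivity) (by linarith)).trans h₁.le
    · change u x ≤ (n : ℝ) + 1
      linarith
    · exact mem_spanningSets_of_index_le _ _ (le_max_of_le_right (le_max_left _ _))
    · exact mem_spanningSets_of_index_le _ _ (le_max_of_le_right (le_max_right _ _))
  obtain ⟨n, hn⟩ : ∃ n, (μ₁.prod μ₂) (S n) ≠ 0 := by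
    by_contra! h
    refine hf (Subtype.ext (AEEqFun.ext ?_))
    have h0 : (μ₁.prod μ₂) (⋃ n, S n) = 0 := measure_iUnion_null h
    filter_upwards [measure_eq_zero_iff_ae_notMem.1 h0, AEEqFun.coeFn_zero (μ := μ₁.prod μ₂) (β := ℂ)] with x hx hx0
    rw [Submodule.coe_zero, hx0]
    by_contra hne
    exact hx (mem_iUnion.2 (hcov x hne))
  obtain ⟨e, he, -⟩ := A.exists_eq_indicator (hS n) f (t := 1 / ((n : ℝ) + 1)) (by positivity)
    (.of_forall fun x hx => hx.1.1)
  refine ⟨n + 1, S n, spanningSets μ₁ n, spanningSets μ₂ n, e, by positivity, hS n,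
    measurableSet_spanningSets _ _, measurableSet_spanningSets _ _,
    measure_spanningSets_lt_top _ _, measure_spanningSets_lt_top _ _, inter_subset_right,
    fun x hx => hx.1.2, he, ?_⟩
  refine (apply_nonneg A.norm e).lt_of_ne' fun h0 => hn ?_
  have he0 := A.definite e h0
  rw [he0] at he
  refine measure_eq_zero_iff_ae_notMem.2 ?_
  filter_upwards [he, AEEqFun.coeFn_zero (μ := μ₁.prod μ₂) (β := ℂ)] with x hx hx0 hxS
  rw [Submodule.coe_zero, hx0, indicator_of_mem hxS] at hx
  exact zero_ne_one hx

/-- The factors of `U_j` may have infinite measure. By σ-finiteness, a subset of finite measure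
exceeds half of `min 1 (ν s)`, which costs a factor `2`. -/
theorem exists_subset_measure_lt_top_min_one_le {Y : Type*} [MeasurableSpace Y] {ν : Measure Y}
    [SigmaFinite ν] {s : Set Y} (hs : MeasurableSet s) (h0 : 0 < ν s) :
    ∃ t ⊆ s, MeasurableSet t ∧ ν t < ∞ ∧ (min 1 (ν s)).toReal ≤ 2 * min 1 (ν.real t) := by
  have htop : min 1 (ν s) ≠ ∞ := (min_lt_of_left_lt ENNReal.one_lt_top).ne
  have hlt : min 1 (ν s) / 2 < ν s :=
    (ENNReal.half_lt_self (lt_min one_pos h0).ne' htop).trans_le (min_le_right _ _)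
  obtain ⟨t, htm, hts, hrt, htf⟩ := Measure.exists_subset_measure_lt_top hs hlt
  refine ⟨t, hts, htm, htf, ?_⟩
  have h1 : (min 1 (ν s)).toReal / 2 ≤ ν.real t := by
    have := ENNReal.toReal_mono htf.ne hrt.le
    simpa [ENNReal.toReal_div, Measure.real] using this
  have h2 : (min 1 (ν s)).toReal ≤ 1 :=
    ENNReal.toReal_le_of_le_ofReal zero_le_one (by simp)
  rcases min_cases 1 (ν.real t) with h | h <;> linarith

/-- Bound the maximum by `e + a`, then use `min 1 a ≤ a` on the first term and `min 1 a ≤ 1` on the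
second. -/
theorem min_one_mul_max_le {a e : ℝ} (ha : 0 ≤ a) (he : 0 ≤ e) :
    min 1 a * max e a ≤ (1 + e) * a := by
  rcases le_total 1 a with h | h <;> rcases le_total e a with h' | h' <;> simp [h, h'] <;>
    nlinarith

/-- Functions of a solid space on which `ℬ_m` acts that are at least `t` on a set `U_j` of the
covering have norm at least a constant times `t (w_𝒰)_j / u`. -/
theorem exists_mul_coveringWeight_le {V : J → Set X₁} {W : J → Set X₂}
    (hU : IsProductAdmissibleCovering μ₁ μ₂ V W) {A : SolidBanachFunctionSpace (μ₁.prod μ₂)}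
    {m : (X₁ × X₂) × (X₁ × X₂) → ℝ} {u : X₁ × X₂ → ℝ} (hu : Measurable u) (hu0 : ∀ x, 0 < u x)
    {Cm : ℝ} (hCm : 0 < Cm) (hm : ∀ x y, m (x, y) ≤ Cm * u x * u y)
    (hmod : IsModerateFor (fun j => V j ×ˢ W j) u) (hA : KernelBmActsOn μ₁ μ₂ m A)
    {f₀ : A.carrier} (hf₀ : f₀ ≠ 0) :
    ∃ D : ℝ, 0 < D ∧ ∀ j, ∀ x ∈ V j ×ˢ W j, ∀ (g : A.carrier) (t : ℝ), 0 < t →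
      (∀ᵐ z ∂μ₁.prod μ₂, z ∈ V j ×ˢ W j → t ≤ ‖(g : X₁ × X₂ →ₘ[μ₁.prod μ₂] ℂ) z‖) →
      t * coveringWeight μ₁ μ₂ V W j ≤ D * u x * A.norm g := by
  obtain ⟨c, hact⟩ := hA
  obtain ⟨Cu, hCu, hmod⟩ := hmod
  obtain ⟨M, E, E₁, E₂, e, hM, hE, hE₁, hE₂, hE₁', hE₂', hEE, huE, he, he0⟩ :=
    A.exists_indicator_norm_pos hu hf₀
  set N := A.norm e
  set e₁ := μ₁.real E₁
  set e₂ := μ₂.real E₂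
  have he₁ : 0 ≤ e₁ := measureReal_nonneg
  have he₂ : 0 ≤ e₂ := measureReal_nonneg
  -- The `4` comes from passing to finite subsets in both factors, `Cm * M * Cu` from bounding `m`
  -- on `E × F`, and `(1 + e₁) * (1 + e₂)` from `min_one_mul_max_le`. Using `|c| + 1` keeps the
  -- constant positive whatever `c` is.
  refine ⟨4 * ((|c| + 1) * (Cm * M * Cu) * (1 + e₁) * (1 + e₂)) / N, by positivity,
    fun j x hx g t ht hg => ?_⟩
  obtain ⟨F₁, hF₁V, hF₁, hF₁', hF₁w⟩ :=
    exists_subset_measure_lt_top_min_one_le (hU.measurableSet_left j) (hU.measure_left_pos j)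
  obtain ⟨F₂, hF₂W, hF₂, hF₂', hF₂w⟩ :=
    exists_subset_measure_lt_top_min_one_le (hU.measurableSet_right j) (hU.measure_right_pos j)
  have hFU : F₁ ×ˢ F₂ ⊆ V j ×ˢ W j := prod_mono hF₁V hF₂W
  obtain ⟨f, hf, hfn⟩ := A.exists_eq_indicator (hF₁.prod hF₂) g ht
    (hg.mono fun z hz hzF => hz (hFU hzF))
  have hux := hu0 x
  have key := measure_mul_norm_le hact hE hE₁ hE₂ hF₁ hF₂ hE₁' hE₂' hF₁' hF₂' hEE
    (D := Cm * M * (Cu * u x)) (by positivity)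
    (fun y hy z hz => (hm y z).trans (by
      have := hu0 z
      gcongr
      · exact huE y hy
      · exact hmod j z (hFU hz) x hx)) he hf
  set a := μ₁.real F₁
  set b := μ₂.real F₂
  have hwj := hU.coveringWeight_pos j
  have hw : coveringWeight μ₁ μ₂ V W j ≤ 4 * (min 1 a * min 1 b) := by
    rw [coveringWeight_eq_mul]
    calc _ ≤ (2 * min 1 a) * (2 * min 1 b) :=
          mul_le_mul hF₁w hF₂w ENNReal.toReal_nonneg (ENNReal.toReal_nonneg.trans hF₁w)
      _ = _ := by ring
  have ha : 0 ≤ a := measureReal_nonneg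
  have hb : 0 ≤ b := measureReal_nonneg
  have hpq : 0 < min 1 a * min 1 b := by linarith
  have ha0 : 0 < a := ha.lt_of_ne' fun h => by simp [h] at hpq
  have hb0 : 0 < b := hb.lt_of_ne' fun h => by simp [h] at hpq
  have hfnn := apply_nonneg A.norm f
  have h1 : min 1 a * min 1 b * N
      ≤ (|c| + 1) * (Cm * M * (Cu * u x)) * (1 + e₁) * (1 + e₂) * A.norm f := by
    -- The rank-one test has `μ(F) = a * b` on its left side. Multiplied by both minima, its right
    -- side also acquires a factor `a * b`, which cancels.
    refine le_of_mul_le_mul_left ?_ (mul_pos ha0 hb0)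
    calc a * b * (min 1 a * min 1 b * N) = min 1 a * min 1 b * (a * b * N) := by ring
      _ ≤ min 1 a * min 1 b *
          (|c| * (Cm * M * (Cu * u x) * max e₁ a * max e₂ b) * A.norm f) := by gcongr
      _ = |c| * (Cm * M * (Cu * u x)) * (min 1 a * max e₁ a) * (min 1 b * max e₂ b)
          * A.norm f := by ring
      _ ≤ (|c| + 1) * (Cm * M * (Cu * u x)) * ((1 + e₁) * a) * ((1 + e₂) * b) * A.norm f := by
          have h3 : 0 ≤ min 1 b * max e₂ b := by positivity
          gcongr ?_ * ?_ * ?_ * ?_ * _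
          · linarith
          · exact min_one_mul_max_le ha he₁
          · exact min_one_mul_max_le hb he₂
      _ = _ := by ring
  refine le_of_mul_le_mul_right ?_ he0
  calc t * coveringWeight μ₁ μ₂ V W j * N ≤ t * (4 * (min 1 a * min 1 b)) * N := by gcongr
    _ = 4 * t * (min 1 a * min 1 b * N) := by ring
    _ ≤ 4 * t * ((|c| + 1) * (Cm * M * (Cu * u x)) * (1 + e₁) * (1 + e₂) * A.norm f) := by gcongr
    _ = 4 * ((|c| + 1) * (Cm * M * (Cu * u x)) * (1 + e₁) * (1 + e₂)) * (t * A.norm f) := by ring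
    _ ≤ 4 * ((|c| + 1) * (Cm * M * (Cu * u x)) * (1 + e₁) * (1 + e₂)) * A.norm g := by gcongr
    _ = 4 * ((|c| + 1) * (Cm * M * Cu) * (1 + e₁) * (1 + e₂)) / N * u x * A.norm g * N := by
        field_simp

end LowerBound

/-! ### The pointwise upper bound for the absolute integrals. -/

section UpperBound

theorem enorm_le_maximalKernel {X J : Type*} {U : J → Set X} (K : X × X → ℂ) {j : J} {x z : X}
    (hx : x ∈ U j) (hz : z ∈ U j) (y : X) : ‖K (x, y)‖ₑ ≤ maximalKernel U K (z, y) :=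
  le_iSup₂ (f := fun a (_ : a ∈ coveringNeighborhood U z) => ‖K (a, y)‖ₑ) x
    (mem_iUnion₂.2 ⟨j, hz, hx⟩)

theorem lintegral_iSup_min_nat {X : Type*} [MeasurableSpace X] {μ : Measure X}
    {k h : X → ℝ≥0∞} (hk : Measurable k) (hh : AEMeasurable h μ) :
    ∫⁻ y, k y * h y ∂μ = ⨆ n : ℕ, ∫⁻ y, min (k y) n * h y ∂μ := by
  rw [← lintegral_iSup' (f := fun (n : ℕ) y => min (k y) n * h y) (fun n => (hk.min measurable_const).aemeasurable.mul hh)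
    (.of_forall fun y n n' hn => by dsimp only; gcongr)]
  congr 1 with y
  rw [← ENNReal.iSup_mul]
  congr 1
  rw [← inf_iSup_eq (a := k y) (f := fun n : ℕ => (n : ℝ≥0∞)), ENNReal.iSup_natCast, inf_top_eq]

variable {X₁ X₂ J : Type*} [MeasurableSpace X₁] [MeasurableSpace X₂]
  {μ₁ : Measure X₁} {μ₂ : Measure X₂}

/-- Truncations of a kernel `L` of finite `ℬ_m`-norm act on `A`, uniformly in the truncation
level. -/
theorem exists_norm_le_lintegral_min {A : SolidBanachFunctionSpace (μ₁.prod μ₂)}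
    {m : (X₁ × X₂) × (X₁ × X₂) → ℝ} (hA : KernelBmActsOn μ₁ μ₂ m A)
    {L : (X₁ × X₂) × (X₁ × X₂) → ℝ≥0∞} (hL : Measurable L)
    (hLfin : kernelNormBm μ₁ μ₂ μ₁ μ₂ m L < ∞) :
    ∃ B : ℝ, 0 ≤ B ∧ ∀ (n : ℕ) (f : A.carrier), ∃ g : A.carrier, A.norm g ≤ B * A.norm f ∧
      ∀ᵐ z ∂μ₁.prod μ₂,
        ∫⁻ y, min (L (z, y)) n * ‖(f : X₁ × X₂ →ₘ[μ₁.prod μ₂] ℂ) y‖ₑ ∂μ₁.prod μ₂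
          = ‖(g : X₁ × X₂ →ₘ[μ₁.prod μ₂] ℂ) z‖ₑ := by
  obtain ⟨c, hact⟩ := hA
  refine ⟨|c| * (kernelNormBm μ₁ μ₂ μ₁ μ₂ m L).toReal, by positivity, fun n f => ?_⟩
  -- Truncation makes the kernel finite, hence an admissible complex kernel with norm at most that
  -- of `L`. It is applied to `|f|`, so that no cancellation occurs.
  let K : (X₁ × X₂) × (X₁ × X₂) → ℂ := fun z => (((min (L z) n).toReal : ℝ) : ℂ)
  have hKm : Measurable K :=
    Complex.measurable_ofReal.comp (hL.min measurable_const).ennreal_toReal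
  have hKe : ∀ z, ‖K z‖ₑ = min (L z) n := fun z => by
    have hne : min (L z) n ≠ ∞ := (min_lt_of_right_lt (ENNReal.natCast_lt_top n)).ne
    rw [← ofReal_norm, Complex.norm_real, Real.norm_of_nonneg ENNReal.toReal_nonneg,
      ENNReal.ofReal_toReal hne]
  have hKle : kernelNormBm μ₁ μ₂ μ₁ μ₂ m (fun z => ‖K z‖ₑ) ≤ kernelNormBm μ₁ μ₂ μ₁ μ₂ m L :=
    kernelNormBm_mono _ _ _ _ _ fun z => (hKe z).trans_le (min_le_left _ _)
  obtain ⟨f', hf', hfn⟩ := A.exists_norm f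
  obtain ⟨hex, g, hg, hgn⟩ := hact K ⟨hKm, hKle.trans_lt hLfin⟩ f'
  refine ⟨g, ?_, ?_⟩
  · have := apply_nonneg A.norm f
    have := apply_nonneg A.norm f'
    calc A.norm g ≤ _ := hgn
      _ ≤ |c| * (kernelNormBm μ₁ μ₂ μ₁ μ₂ m L).toReal * A.norm f := by
          gcongr
          · exact le_abs_self c
          · exact hLfin.ne
  · filter_upwards [hex, hg] with z hz hgz
    have hae : (fun y => K (z, y) * (f' : X₁ × X₂ →ₘ[μ₁.prod μ₂] ℂ) y) =ᵐ[μ₁.prod μ₂]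
        fun y => (((min (L (z, y)) n).toReal
          * ‖(f : X₁ × X₂ →ₘ[μ₁.prod μ₂] ℂ) y‖ : ℝ) : ℂ) := by
      filter_upwards [hf'] with y hy
      rw [hy, Complex.ofReal_mul]
    have hint : Integrable (fun y => (min (L (z, y)) n).toReal
        * ‖(f : X₁ × X₂ →ₘ[μ₁.prod μ₂] ℂ) y‖) (μ₁.prod μ₂) := by
      have := (hz.congr hae).re
      simpa using this
    rw [hgz, kernelOp, integral_congr_ae hae, integral_complex_ofReal, ← ofReal_norm,
      Complex.norm_real, Real.norm_of_nonneg (integral_nonneg fun y => by positivity),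
      ofReal_integral_eq_lintegral_ofReal hint (.of_forall fun y => by positivity)]
    refine lintegral_congr fun y => ?_
    rw [ENNReal.ofReal_mul ENNReal.toReal_nonneg, ofReal_norm, ENNReal.ofReal_toReal
      (min_lt_of_right_lt (ENNReal.natCast_lt_top n)).ne]

/-- The absolute integrals `∫ |K(x,y)| |f(y)| dμ(y)` are bounded by a multiple of
`u(x) / w(x) * ‖f‖`, at every point `x`. -/
theorem exists_lintegral_enorm_le [SigmaFinite μ₁] [SigmaFinite μ₂] {V : J → Set X₁} {W : J → Set X₂}
    (hU : IsProductAdmissibleCovering μ₁ μ₂ V W) {A : SolidBanachFunctionSpace (μ₁.prod μ₂)}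
    {m : (X₁ × X₂) × (X₁ × X₂) → ℝ} {u : X₁ × X₂ → ℝ} (hu : Measurable u) (hu0 : ∀ x, 0 < u x)
    {Cm : ℝ} (hCm : 0 < Cm) (hm : ∀ x y, m (x, y) ≤ Cm * u x * u y)
    (hmod : IsModerateFor (fun j => V j ×ˢ W j) u) (hA : KernelBmActsOn μ₁ μ₂ m A)
    {K : (X₁ × X₂) × (X₁ × X₂) → ℂ} {L : (X₁ × X₂) × (X₁ × X₂) → ℝ≥0∞}
    (hK : Measurable K) (hL : Measurable L)
    (hKL : ∀ z, maximalKernel (fun j => V j ×ˢ W j) K z ≤ L z)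
    (hLfin : kernelNormBm μ₁ μ₂ μ₁ μ₂ m L < ∞) {w : X₁ × X₂ → ℝ}
    (hw : IsContinuousCoveringWeight μ₁ μ₂ V W w) :
    ∃ C : ℝ, ∀ (f : A.carrier) (x : X₁ × X₂),
      ∫⁻ y, ‖K (x, y)‖ₑ * ‖(f : X₁ × X₂ →ₘ[μ₁.prod μ₂] ℂ) y‖ₑ ∂μ₁.prod μ₂
        ≤ ENNReal.ofReal (C * (u x / w x) * A.norm f) := by
  -- The lower bound needs a nonzero element of `A`; if there is none, the integrals vanish.
  by_cases hne : ∃ f₀ : A.carrier, f₀ ≠ 0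
  swap
  · push Not at hne
    refine ⟨0, fun f x => ?_⟩
    rw [hne f, lintegral_congr_ae (g := fun _ => 0), lintegral_zero]
    · exact zero_le
    · filter_upwards [AEEqFun.coeFn_zero (μ := μ₁.prod μ₂) (β := ℂ)] with y hy
      rw [Submodule.coe_zero, hy, Pi.zero_apply, enorm_zero, mul_zero]
  obtain ⟨f₀, hf₀⟩ := hne
  obtain ⟨D, hD, hlow⟩ := exists_mul_coveringWeight_le hU hu hu0 hCm hm hmod hA hf₀
  obtain ⟨B, hB, hup⟩ := exists_norm_le_lintegral_min hA hL hLfin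
  obtain ⟨Cw, hCw, hwb⟩ := hw.exists_bounds hU
  refine ⟨Cw * D * B, fun f x => ?_⟩
  have hux := hu0 x
  have hwx := hw.pos x
  have hfnn := apply_nonneg A.norm f
  rw [lintegral_iSup_min_nat (k := fun y => ‖K (x, y)‖ₑ) (hK.comp measurable_prodMk_left).enorm
    (f : X₁ × X₂ →ₘ[μ₁.prod μ₂] ℂ).stronglyMeasurable.enorm.aemeasurable]
  -- The truncated integral is not yet known to be finite, so it is approached by finite `t` below
  -- it.
  refine iSup_le fun n => ENNReal.le_of_forall_nnreal_lt fun t ht => ?_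
  rcases eq_or_ne t 0 with rfl | ht0
  · simp
  obtain ⟨j, hj⟩ := hU.exists_mem x
  obtain ⟨g, hgn, hg⟩ := hup n f
  have htg : ∀ᵐ z ∂μ₁.prod μ₂, z ∈ V j ×ˢ W j →
      (t : ℝ) ≤ ‖(g : X₁ × X₂ →ₘ[μ₁.prod μ₂] ℂ) z‖ := by
    -- As `x` and `z` share `U_j`, the kernel at `x` is dominated by `L` at `z`, also after
    -- truncation at the same level.
    filter_upwards [hg] with z hz hzU
    have h1 : (t : ℝ≥0∞) ≤ ‖(g : X₁ × X₂ →ₘ[μ₁.prod μ₂] ℂ) z‖ₑ := by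
      refine ht.le.trans (le_trans (lintegral_mono fun y => ?_) hz.le)
      dsimp only
      gcongr
      exact (enorm_le_maximalKernel (U := fun j => V j ×ˢ W j) K hj hzU y).trans (hKL (z, y))
    exact_mod_cast h1
  have h := hlow j x hj g t (NNReal.coe_pos.2 (pos_of_ne_zero ht0)) htg
  have hle : (t : ℝ) ≤ Cw * D * B * (u x / w x) * A.norm f := by
    refine le_of_mul_le_mul_right ?_ hwx
    calc (t : ℝ) * w x ≤ t * (Cw * coveringWeight μ₁ μ₂ V W j) := by
          gcongr
          exact (hwb j x hj).2
      _ = Cw * (t * coveringWeight μ₁ μ₂ V W j) := by ring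
      _ ≤ Cw * (D * u x * A.norm g) := mul_le_mul_of_nonneg_left h hCw.le
      _ ≤ Cw * (D * u x * (B * A.norm f)) := by gcongr
      _ = Cw * D * B * (u x / w x) * A.norm f * w x := by field_simp
  exact (ENNReal.ofReal_coe_nnreal (p := t)).symm.trans_le (ENNReal.ofReal_le_ofReal hle)

end UpperBound

/-! ### Assembly of the theorem. -/

theorem mainTheorem9 {X₁ X₂ J : Type*} [MeasurableSpace X₁] [MeasurableSpace X₂]
    (μ₁ : Measure X₁) (μ₂ : Measure X₂) [SigmaFinite μ₁] [SigmaFinite μ₂]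
    (V : J → Set X₁) (W : J → Set X₂) (hU : IsProductAdmissibleCovering μ₁ μ₂ V W) :
    -- (1) existence and uniqueness, up to equivalence, of the continuous covering weight
    ((∃ w : X₁ × X₂ → ℝ, IsContinuousCoveringWeight μ₁ μ₂ V W w) ∧
      (∀ w w' : X₁ × X₂ → ℝ, IsContinuousCoveringWeight μ₁ μ₂ V W w →
        IsContinuousCoveringWeight μ₁ μ₂ V W w' →
        ∃ C : ℝ, 0 < C ∧ ∀ x, w x ≤ C * w' x ∧ w' x ≤ C * w x)) ∧
    -- (2) boundedness of the integral operator
    (∀ (m : (X₁ × X₂) × (X₁ × X₂) → ℝ) (u : X₁ × X₂ → ℝ),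
      Measurable m → (∀ z, 0 < m z) → Measurable u → (∀ x, 0 < u x) →
      (∃ C : ℝ, 0 < C ∧ ∀ x y, m (x, y) ≤ C * u x * u y) →
      IsModerateFor (fun j => V j ×ˢ W j) u →
      ∀ A : SolidBanachFunctionSpace (μ₁.prod μ₂), KernelBmActsOn μ₁ μ₂ m A →
      ∀ (K : (X₁ × X₂) × (X₁ × X₂) → ℂ) (L : (X₁ × X₂) × (X₁ × X₂) → ℝ≥0∞),
        Measurable K → Measurable L →
        (∀ z, maximalKernel (fun j => V j ×ˢ W j) K z ≤ L z) →
        kernelNormBm μ₁ μ₂ μ₁ μ₂ m L < ∞ →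
      ∀ w : X₁ × X₂ → ℝ, IsContinuousCoveringWeight μ₁ μ₂ V W w →
      ∀ v : X₁ × X₂ → ℝ, (∀ x, v x = u x / w x) →
        MemKernelBm μ₁ μ₂ μ₁ μ₂ m K ∧
        (∃ C : ℝ, KernelOpBoundedOn K A C) ∧
        (∃ C : ℝ, KernelOpBoundedIntoWeightedLInfty K A (fun x => 1 / v x) C)) := by
  refine ⟨⟨hU.exists_isContinuousCoveringWeight, fun w w' hw hw' => hw.equivalent hU hw'⟩, ?_⟩
  rintro m u - - hu hu0 ⟨Cm, hCm, hm⟩ hmod A hA K L hK hL hKL hLfin w hw v hv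
  have hKB : MemKernelBm μ₁ μ₂ μ₁ μ₂ m K := by
    refine ⟨hK, (kernelNormBm_mono _ _ _ _ m fun z => ?_).trans_lt hLfin⟩
    -- Every point lies in its own neighborhood `𝒰(x)`, hence `|K| ≤ M_𝒰 K ≤ L`.
    obtain ⟨j, hj⟩ := hU.exists_mem z.1
    exact (enorm_le_maximalKernel (U := fun j => V j ×ˢ W j) K hj hj z.2).trans (hKL z)
  obtain ⟨C, hbound⟩ :=
    exists_lintegral_enorm_le hU hu hu0 hCm hm hmod hA hK hL hKL hLfin hw
  obtain ⟨c, hact⟩ := hA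
  refine ⟨hKB, ⟨_, hact K hKB⟩, C, fun f => ?_⟩
  obtain ⟨hex, g, hg, -⟩ := hact K hKB f
  refine ⟨hex, (g : X₁ × X₂ →ₘ[μ₁.prod μ₂] ℂ).aestronglyMeasurable.congr hg, ?_⟩
  rw [eLpNorm_exponent_top]
  refine eLpNormEssSup_le_of_ae_enorm_bound (.of_forall fun x => ?_)
  have hvx : 0 < u x / w x := div_pos (hu0 x) (hw.pos x)
  have hop : ‖kernelOp (μ₁.prod μ₂) K (f : X₁ × X₂ →ₘ[μ₁.prod μ₂] ℂ) x‖ₑ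
      ≤ ENNReal.ofReal (C * (u x / w x) * A.norm f) := by
    refine (enorm_integral_le_lintegral_enorm _).trans ?_
    simpa only [enorm_mul] using hbound f x
  simp only [hv]
  rw [enorm_mul, ← ofReal_norm, Complex.norm_real,
    Real.norm_of_nonneg (one_div_nonneg.2 hvx.le)]
  calc _ ≤ ENNReal.ofReal (1 / (u x / w x)) * ENNReal.ofReal (C * (u x / w x) * A.norm f) := by
        gcongr
    _ = ENNReal.ofReal (C * A.norm f) := by
        rw [← ENNReal.ofReal_mul (one_div_nonneg.2 hvx.le)]
        congr 1
        rw [mul_right_comm, one_div, mul_comm, mul_inv_cancel_right₀ hvx.ne']
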